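/- For $k<\omega$ let $\widehat F_k$ be the free profinite group on $k$ generators, i.e. the profinite completion of the abstract free group on $k$ generators. For a compact Polish group $G$ let $\mathcal N(G)$ be the set of closed normal subgroups of $G$, with the topology inherited from the hyperspace $\mathcal K(G)$ of compact subsets of $G$ (the topology given by the Hausdorff distance of any compatible metric on $G$); it is a Polish space. Give the disjoint union $\mathcal X=\bigsqcup_{k<\omega}\mathcal N(\widehat F_k)$ the disjoint union topology, which is again Polish. A point $R\in\mathcal N(\widehat F_k)$ codes the topologically finitely generated profinite group $\widehat F_k/R$, and every such group is isomorphic to one of this form. Let $E_{f.g.}$ be the equivalence relation on $\mathcal X$ which relates $R\in\mathcal N(\widehat F_k)$ and $S\in\mathcal N(\widehat F_l)$ if and only if $\widehat F_k/R$ and $\widehat F_l/S$ are isomorphic as topological groups. For equivalence relations $E,F$ on Polish spaces $X,Y$ write $E\le_B F$ if there is a Borel function $g\colon X\to Y$ such that $u\mathrel{E}v\Leftrightarrow g(u)\mathrel{F}g(v)$ for all $u,v\in X$. **Theorem.** $E_{f.g.}$ is Borel equivalent to the identity relation $\mathrm{id}_{\mathbb R}$ on $\mathbb R$; that is, $E_{f.g.}\le_B\mathrm{id}_{\mathbb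 R}$ and $\mathrm{id}_{\mathbb R}\le_B E_{f.g.}$. -/

import Mathlib

open TopologicalSpace Topology

theorem polishSpace_of_compact_t2 (X : Type*) [TopologicalSpace X] [CompactSpace X] [T2Space X]
    [SecondCountableTopology X] : PolishSpace X := by
  let := metrizableSpaceMetric X
  infer_instance

/-- The free profinite group `F̂_k` on `k` generators: the profinite completion of the abstract
free group on `k` generators. -/
abbrev FreeProfiniteGroup (k : ℕ) : ProfiniteGrp.{0} :=
  ProfiniteGrp.ProfiniteCompletion.completion (GrpCat.of (FreeGroup (Fin k)))

/-- The collection `𝒩(G)` of closed normal subgroups of a topological group `G`. -/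
structure ClosedNormalSubgroup (G : Type*) [Group G] [TopologicalSpace G] where
  /-- The underlying subgroup. -/
  toSubgroup : Subgroup G
  isClosed : IsClosed (toSubgroup : Set G)
  normal : toSubgroup.Normal

namespace ClosedNormalSubgroup

instance instNormal {G : Type*} [Group G] [TopologicalSpace G] (N : ClosedNormalSubgroup G) :
    N.toSubgroup.Normal := N.normal

/-- The inclusion of `𝒩(G)` into the hyperspace `𝒦(G)` of compact subsets of a compact group. -/
def toCompacts {G : Type*} [Group G] [TopologicalSpace G] [CompactSpace G]
    (N : ClosedNormalSubgroup G) : Compacts G :=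
  ⟨(N.toSubgroup : Set G), N.isClosed.isCompact⟩

/-- `𝒩(G)` carries the subspace topology from the hyperspace `𝒦(G)` of compact subsets of `G`,
whose topology is the Vietoris topology (for compact metrizable `G` it is the topology of the
Hausdorff distance of any compatible metric). -/
instance instTopologicalSpace {G : Type*} [Group G] [TopologicalSpace G] [CompactSpace G] :
    TopologicalSpace (ClosedNormalSubgroup G) :=
  TopologicalSpace.induced toCompacts inferInstance

theorem toCompacts_injective {G : Type*} [Group G] [TopologicalSpace G] [CompactSpace G] :
    Function.Injective (toCompacts : ClosedNormalSubgroup G → Compacts G) := by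
  rintro ⟨A, hA, hA'⟩ ⟨B, hB, hB'⟩ h
  have h' : (A : Set G) = B := congrArg (fun K : Compacts G => (K : Set G)) h
  obtain rfl := SetLike.coe_injective h'
  rfl

theorem isClosedEmbedding_toCompacts {G : Type*} [Group G] [TopologicalSpace G]
    [IsTopologicalGroup G] [CompactSpace G] [T2Space G] :
    IsClosedEmbedding (toCompacts : ClosedNormalSubgroup G → Compacts G) := by
  refine ⟨⟨⟨rfl⟩, toCompacts_injective⟩, ?_⟩
  have hdiv : Continuous fun p : G × G => p.1 * p.2⁻¹ := by fun_prop
  have hconj : ∀ g : G, Continuous fun x : G => g * x * g⁻¹ := fun g => by fun_prop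
  have hrange : Set.range (toCompacts : ClosedNormalSubgroup G → Compacts G) =
      {(⊥ : Compacts G)}ᶜ ∩
        ({K | (K ×ˢ K).map _ hdiv ⊔ K = K} ∩ ⋂ g : G, {K | K.map _ (hconj g) ⊔ K = K}) := by
    ext K
    simp only [Set.mem_inter_iff, Set.mem_iInter, Set.mem_ofPred_eq, sup_eq_right,
      Set.mem_compl_iff, Set.mem_singleton_iff]
    constructor
    · rintro ⟨N, rfl⟩
      refine ⟨fun h => ?_, ?_, fun g => ?_⟩
      · have h1 : (1 : G) ∈ N.toCompacts := N.toSubgroup.one_mem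
        rw [h] at h1
        exact h1
      · rintro _ ⟨⟨a, b⟩, ⟨ha, hb⟩, rfl⟩
        exact N.toSubgroup.mul_mem ha (N.toSubgroup.inv_mem hb)
      · rintro _ ⟨a, ha, rfl⟩
        exact N.normal.conj_mem a ha g
    · rintro ⟨h0, h1, h2⟩
      have hd : ∀ a ∈ K, ∀ b ∈ K, a * b⁻¹ ∈ K := fun a ha b hb =>
        h1 ⟨(a, b), ⟨ha, hb⟩, rfl⟩
      have hne : ∃ a, a ∈ K := by
        by_contra hcon
        push Not at hcon
        exact h0 (by ext x; simpa using hcon x)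
      obtain ⟨a, ha⟩ := hne
      have hone : (1 : G) ∈ K := by simpa using hd a ha a ha
      have hinv : ∀ b ∈ K, b⁻¹ ∈ K := fun b hb => by simpa using hd 1 hone b hb
      refine ⟨⟨⟨⟨⟨(K : Set G), fun {x y} hx hy => ?_⟩, hone⟩, fun {x} hx => hinv x hx⟩,
        K.isCompact.isClosed, ⟨fun n hn g => h2 g ⟨n, hn, rfl⟩⟩⟩, ?_⟩
      · simpa using hd x hx _ (hinv y hy)
      · ext x; rfl
  rw [hrange]
  refine Compacts.isClopen_singleton_bot.compl.isClosed.inter (IsClosed.inter ?_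
    (isClosed_iInter fun g => ?_))
  · exact isClosed_eq ((hdiv.compacts_map.comp
      (Compacts.continuous_prod.comp (continuous_id.prodMk continuous_id))).sup continuous_id)
      continuous_id
  · exact isClosed_eq ((hconj g).compacts_map.sup continuous_id) continuous_id

/-- The space of closed normal subgroups of a compact Polish group is Polish. -/
instance instPolishSpace {G : Type*} [Group G] [TopologicalSpace G]
    [IsTopologicalGroup G] [CompactSpace G] [PolishSpace G] :
    PolishSpace (ClosedNormalSubgroup G) :=
  haveI : PolishSpace (Compacts G) := polishSpace_of_compact_t2 _
  isClosedEmbedding_toCompacts.polishSpace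

end ClosedNormalSubgroup

/-- A finitely generated free group has only countably many normal subgroups of finite index. -/
instance FreeGroup.instCountableFiniteIndexNormalSubgroup (k : ℕ) :
    Countable (FiniteIndexNormalSubgroup (FreeGroup (Fin k))) := by
  let f : (Σ n : ℕ, (Fin k → Equiv.Perm (Fin n))) → Subgroup (FreeGroup (Fin k)) :=
    fun p => (FreeGroup.lift p.2).ker
  have key : ∀ H : FiniteIndexNormalSubgroup (FreeGroup (Fin k)), H.toSubgroup ∈ Set.range f := by
    intro H
    have : Finite (FreeGroup (Fin k) ⧸ H.toSubgroup) := Subgroup.finite_quotient_of_finiteIndex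
    obtain ⟨n, ⟨e⟩⟩ := Finite.exists_equiv_fin (FreeGroup (Fin k) ⧸ H.toSubgroup)
    let φ : FreeGroup (Fin k) →* Equiv.Perm (Fin n) :=
      (e.permCongrHom.toMonoidHom.comp (MulAction.toPermHom (FreeGroup (Fin k) ⧸ H.toSubgroup)
        (FreeGroup (Fin k) ⧸ H.toSubgroup))).comp (QuotientGroup.mk' H.toSubgroup)
    refine ⟨⟨n, fun i => φ (FreeGroup.of i)⟩, ?_⟩
    have h1 : FreeGroup.lift (fun i => φ (FreeGroup.of i)) = φ := by
      ext1 i; simp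
    change (FreeGroup.lift _).ker = _
    rw [h1]
    have hinj : Function.Injective (e.permCongrHom.toMonoidHom.comp
        (MulAction.toPermHom (FreeGroup (Fin k) ⧸ H.toSubgroup)
          (FreeGroup (Fin k) ⧸ H.toSubgroup))) :=
      e.permCongrHom.injective.comp MulAction.toPerm_injective
    ext x
    rw [MonoidHom.mem_ker, ← QuotientGroup.eq_one_iff (N := H.toSubgroup)]
    exact map_eq_one_iff _ hinj
  have hc : (Set.range f).Countable := Set.countable_range f
  have := hc.to_subtype
  refine Function.Injective.countable (f := fun H => (⟨H.toSubgroup, key H⟩ : Set.range f)) ?_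
  intro A B h
  exact FiniteIndexNormalSubgroup.toSubgroup_injective (congrArg Subtype.val h)

instance FreeProfiniteGroup.instPolishSpace (k : ℕ) : PolishSpace (FreeProfiniteGroup k) := by
  have : SecondCountableTopology (FreeProfiniteGroup k) := by
    let D := ProfiniteGrp.ProfiniteCompletion.diagram (GrpCat.of (FreeGroup (Fin k)))
    have : Countable (FiniteIndexNormalSubgroup (GrpCat.of (FreeGroup (Fin k)))) :=
      FreeGroup.instCountableFiniteIndexNormalSubgroup k
    have hd : ∀ j, DiscreteTopology (D.obj j) := fun j => ⟨rfl⟩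
    have hf : ∀ j, Finite (D.obj j) := fun j =>
      Subgroup.finite_quotient_of_finiteIndex (H := j.toSubgroup)
    have hs : ∀ j, SecondCountableTopology (D.obj j) := fun j => inferInstance
    have hc : Countable (FiniteIndexNormalSubgroup (FreeGroup (Fin k))) := inferInstance
    have hp : SecondCountableTopology (∀ j, D.obj j) := inferInstance
    exact (IsInducing.subtypeVal (t := {x | x ∈ ProfiniteGrp.limitConePtAux D})).secondCountableTopology
  exact polishSpace_of_compact_t2 _

/-- The space `⊔_{k < ω} 𝒩(F̂_k)`, a disjoint union with the disjoint union topology, of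
topologically finitely generated profinite groups: the point `⟨k, N⟩` codes `F̂_k / N`. -/
abbrev FGProfiniteCode : Type := Σ k : ℕ, ClosedNormalSubgroup (FreeProfiniteGroup k)

/-- The profinite group `F̂_k / N` coded by `⟨k, N⟩`, with the quotient topology. -/
abbrev FGProfiniteCode.group (c : FGProfiniteCode) : Type :=
  FreeProfiniteGroup c.1 ⧸ c.2.toSubgroup

/-- `E_{f.g.}`: two codes are equivalent if the coded groups are isomorphic as topological groups
(`≃ₜ*` is a group isomorphism that is also a homeomorphism). -/
def fgProfiniteIso : Setoid FGProfiniteCode where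
  r c d := Nonempty (c.group ≃ₜ* d.group)
  iseqv :=
    { refl := fun _ => ⟨ContinuousMulEquiv.refl _⟩
      symm := fun ⟨e⟩ => ⟨e.symm⟩
      trans := fun ⟨e⟩ ⟨f⟩ => ⟨e.trans f⟩ }

/-- Borel reducibility `E ≤_B F` of equivalence relations on Polish spaces: there is a Borel
function `g : X → Y` with `u E v ↔ g u F g v` for all `u, v`. -/
def BorelReducible {X Y : Type*} [TopologicalSpace X] [PolishSpace X] [TopologicalSpace Y]
    [PolishSpace Y] (E : Setoid X) (F : Setoid Y) : Prop :=
  ∃ g : X → Y, @Measurable X Y (borel X) (borel Y) g ∧ ∀ u v : X, E u v ↔ F (g u) (g v)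

/-- Borel equivalence (bireducibility) `E ≡_B F`. -/
def BorelBireducible {X Y : Type*} [TopologicalSpace X] [PolishSpace X] [TopologicalSpace Y]
    [PolishSpace Y] (E : Setoid X) (F : Setoid Y) : Prop :=
  BorelReducible E F ∧ BorelReducible F E

/-! A topologically finitely generated profinite group is determined by its finite continuous
quotients. For a fixed finite group `Q` it has only finitely many homomorphisms to `Q` with open
kernel. Compactness therefore turns surjections onto all finite quotients of `H` into one continuous
surjection onto `H`, and the same finiteness makes the groups Hopfian. So two such groups with the
same finite quotients are isomorphic (`nonempty_continuousMulEquiv_of_hasOpenQuotient_iff`). Having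
a given quotient is an open condition on the code, so the list of finite quotients is a Borel
complete invariant in a Cantor space, which embeds in ℝ.

Conversely, distinct primes are assigned to the rationals, and a real `r` is sent to the procyclic
quotient of `F̂_1` whose quotients of these prime orders are exactly those assigned to rationals
below `r`. This family is antitone in `r`, hence Borel. -/

/-! ### Homomorphisms with open kernel -/

/-- `Q` is the image of `G` under a homomorphism with open kernel. -/
def HasOpenQuotient (G Q : Type*) [Group G] [TopologicalSpace G] [Group Q] : Prop :=
  ∃ φ : G →* Q, IsOpen (φ.ker : Set G) ∧ Function.Surjective φ

theorem HasOpenQuotient.of_mulEquiv {G Q Q' : Type*} [Group G] [TopologicalSpace G] [Group Q]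
    [Group Q'] (h : HasOpenQuotient G Q) (e : Q ≃* Q') : HasOpenQuotient G Q' := by
  obtain ⟨φ, ho, hs⟩ := h
  refine ⟨e.toMonoidHom.comp φ, ?_, e.surjective.comp hs⟩
  have : (e.toMonoidHom.comp φ).ker = φ.ker := by
    ext x; simp [MonoidHom.mem_ker]
  rwa [this]

theorem HasOpenQuotient.of_continuousMulEquiv {G H Q : Type*} [Group G] [TopologicalSpace G]
    [Group H] [TopologicalSpace H] [Group Q] (h : HasOpenQuotient G Q) (e : G ≃ₜ* H) :
    HasOpenQuotient H Q := by
  obtain ⟨φ, ho, hs⟩ := h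
  refine ⟨φ.comp e.symm.toMulEquiv.toMonoidHom, ?_, hs.comp e.symm.surjective⟩
  exact ho.preimage e.symm.continuous

/-- Homomorphisms with open kernel which agree on a set of topological generators are equal. -/
theorem MonoidHom.eq_of_eqOn_dense_of_isOpen_ker {G Q : Type*} [Group G] [TopologicalSpace G]
    [IsTopologicalGroup G] [Group Q] {S : Set G} (hS : Dense (Subgroup.closure S : Set G))
    {φ ψ : G →* Q} (hφ : IsOpen (φ.ker : Set G)) (hψ : IsOpen (ψ.ker : Set G))
    (h : Set.EqOn φ ψ S) : φ = ψ := by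
  -- The equalizer contains an open subgroup, so it is open and hence also closed.
  have hle : φ.ker ⊓ ψ.ker ≤ φ.eqLocus ψ := by
    rintro x ⟨h1, h2⟩
    exact (MonoidHom.mem_ker.1 h1).trans (MonoidHom.mem_ker.1 h2).symm
  have ho : IsOpen (φ.eqLocus ψ : Set G) := Subgroup.isOpen_mono hle (hφ.inter hψ)
  have hc : IsClosed (φ.eqLocus ψ : Set G) := Subgroup.isClosed_of_isOpen _ ho
  have hsub : (Subgroup.closure S : Set G) ⊆ φ.eqLocus ψ :=
    (Subgroup.closure_le (φ.eqLocus ψ)).2 h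
  ext x
  exact hc.closure_subset_iff.2 hsub (hS x)

/-- A topologically finitely generated group has finitely many homomorphisms with open kernel to a
given finite group. -/
theorem finite_setOf_isOpen_ker {G Q : Type*} [Group G] [TopologicalSpace G]
    [IsTopologicalGroup G] [Group Q] [Finite Q] {S : Set G} (hfin : S.Finite)
    (hS : Dense (Subgroup.closure S : Set G)) :
    {φ : G →* Q | IsOpen (φ.ker : Set G)}.Finite := by
  have := hfin.to_subtype
  refine Set.Finite.of_injOn (f := fun φ (s : S) => φ s) (t := Set.univ)
    (fun _ _ => Set.mem_univ _) ?_ Set.finite_univ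
  intro φ hφ ψ hψ h
  exact MonoidHom.eq_of_eqOn_dense_of_isOpen_ker hS hφ hψ fun s hs => congrFun h ⟨s, hs⟩

/-! ### Finite quotients determine the group -/

/-- Open normal subgroups of a profinite group separate points. -/
theorem eq_of_forall_openNormalSubgroup {H : Type*} [Group H] [TopologicalSpace H]
    [IsTopologicalGroup H] [CompactSpace H] [TotallyDisconnectedSpace H] {x y : H}
    (h : ∀ V : OpenNormalSubgroup H, (x : H ⧸ V.toSubgroup) = y) : x = y := by
  by_contra hne
  have h1 : (1 : H) ∈ ({x⁻¹ * y}ᶜ : Set H) := by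
    simp only [Set.mem_compl_iff, Set.mem_singleton_iff]
    intro h; exact hne (inv_mul_eq_one.1 h.symm)
  obtain ⟨V, hV⟩ := ProfiniteGrp.exist_openNormalSubgroup_sub_open_nhds_of_one
    isClosed_singleton.isOpen_compl h1
  exact hV (QuotientGroup.eq.1 (h V)) rfl

/-- If `G` is topologically finitely generated and every finite quotient of the profinite group
`H` by an open normal subgroup is a quotient of `G`, then `H` is a quotient of `G`. -/
theorem exists_continuous_surjective_of_hasOpenQuotient {G H : Type*} [Group G]
    [TopologicalSpace G] [IsTopologicalGroup G] [CompactSpace G]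
    {S : Set G} (hfin : S.Finite) (hS : Dense (Subgroup.closure S : Set G))
    [Group H] [TopologicalSpace H]
    [IsTopologicalGroup H] [CompactSpace H] [TotallyDisconnectedSpace H]
    (hq : ∀ V : OpenNormalSubgroup H, HasOpenQuotient G (H ⧸ V.toSubgroup)) :
    ∃ t : G →* H, Continuous t ∧ Function.Surjective t := by
  choose σ hσo hσs using hq
  have : Nonempty (OpenNormalSubgroup H) := ⟨⟨⊤, inferInstanceAs (⊤ : Subgroup H).Normal⟩⟩
  -- The chosen surjections `σ W` need not be compatible. Lifting them to `H` and taking limits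
  -- along an ultrafilter of ever smaller `W` makes them so.
  let U : Ultrafilter (OpenNormalSubgroup H) := Ultrafilter.of Filter.atBot
  have hU : (U : Filter (OpenNormalSubgroup H)) ≤ Filter.atBot := Ultrafilter.of_le _
  have hlim : ∀ g : G, ∃ h : H, Filter.Tendsto (fun W => (σ W g).out) U (𝓝 h) := by
    intro g
    obtain ⟨h, -, hh⟩ := isCompact_univ.ultrafilter_le_nhds (U.map fun W => (σ W g).out) (by simp)
    exact ⟨h, hh⟩
  choose t ht using hlim
  have hχ : ∀ V : OpenNormalSubgroup H, ∃ χ : G →* H ⧸ V.toSubgroup,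
      IsOpen (χ.ker : Set G) ∧ Function.Surjective χ ∧ ∀ g, (t g : H ⧸ V.toSubgroup) = χ g := by
    intro V
    have : Finite (H ⧸ V.toSubgroup) := Subgroup.quotient_finite_of_isOpen _ V.isOpen'
    have hF := finite_setOf_isOpen_ker (Q := H ⧸ V.toSubgroup) hfin hS
    -- For `W ≤ V`, reducing `σ W` modulo `V` gives a member of a finite set of homomorphisms, so
    -- the ultrafilter selects a single `χ`.
    have hev : ∀ᶠ W in (U : Filter (OpenNormalSubgroup H)),
        ∃ χ ∈ {φ : G →* H ⧸ V.toSubgroup | IsOpen (φ.ker : Set G)}, Function.Surjective χ ∧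
          ∀ g, ((σ W g).out : H ⧸ V.toSubgroup) = χ g := by
      filter_upwards [hU (Filter.eventually_le_atBot V)] with W hW
      have hWV : W.toSubgroup ≤ V.toSubgroup := hW
      let m : H ⧸ W.toSubgroup →* H ⧸ V.toSubgroup :=
        QuotientGroup.map _ _ (MonoidHom.id H) hWV
      refine ⟨m.comp (σ W), ?_, ?_, ?_⟩
      · exact Subgroup.isOpen_mono (H₁ := (σ W).ker)
          (fun x hx => by simp [MonoidHom.mem_ker, MonoidHom.mem_ker.1 hx]) (hσo W)
      · have hm : Function.Surjective m := fun x => by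
          obtain ⟨h, rfl⟩ := QuotientGroup.mk_surjective x
          exact ⟨(h : H ⧸ W.toSubgroup), rfl⟩
        exact hm.comp (hσs W)
      · intro g
        change _ = m (σ W g)
        conv_rhs => rw [← QuotientGroup.out_eq' (σ W g)]
        rfl
    rw [Ultrafilter.eventually_exists_mem_iff hF] at hev
    obtain ⟨χ, hχo, hev⟩ := hev
    obtain ⟨W₀, hs, -⟩ := hev.exists
    refine ⟨χ, hχo, hs, fun g => ?_⟩
    have hmem : {h : H | (t g : H ⧸ V.toSubgroup) = h} ∈ 𝓝 (t g) := by
      have : {h : H | (t g : H ⧸ V.toSubgroup) = h} = (fun h => (t g)⁻¹ * h) ⁻¹' (V : Set H) := by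
        ext h; exact QuotientGroup.eq
      rw [this]
      refine (V.isOpen'.preimage (by fun_prop)).mem_nhds ?_
      simp
    obtain ⟨W, hW1, -, hW2⟩ := ((ht g).eventually hmem |>.and hev).exists
    exact hW1.trans (hW2 g)
  choose χ hχo hχs hχt using hχ
  let T : G →* H := MonoidHom.mk' t fun a b => eq_of_forall_openNormalSubgroup fun V => by
    rw [hχt, map_mul, ← hχt, ← hχt]; rfl
  have hT : Continuous T := by
    refine continuous_of_continuousAt_one T ?_
    rw [ContinuousAt, map_one]
    intro s hs
    obtain ⟨s', hs', hso, h1⟩ := mem_nhds_iff.1 hs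
    obtain ⟨V, hV⟩ := ProfiniteGrp.exist_openNormalSubgroup_sub_open_nhds_of_one hso h1
    refine Filter.mem_map.2 (Filter.mem_of_superset
      ((hχo V).mem_nhds (one_mem (χ V).ker)) fun x hx => hs' (hV ?_))
    have : (t x : H ⧸ V.toSubgroup) = 1 := (hχt V x).trans hx
    exact (QuotientGroup.eq_one_iff _).1 this
  refine ⟨T, hT, ?_⟩
  -- The range is closed, so a missed point has a whole coset of some `V` outside the range,
  -- although `χ V` is onto.
  by_contra hns
  simp only [Function.Surjective, not_forall] at hns
  obtain ⟨h, hh⟩ := hns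
  have hc : IsOpen (Set.range T)ᶜ := (isCompact_range hT).isClosed.isOpen_compl
  have ho : IsOpen ((fun x => h * x) ⁻¹' (Set.range T)ᶜ) := hc.preimage (by fun_prop)
  obtain ⟨V, hV⟩ := ProfiniteGrp.exist_openNormalSubgroup_sub_open_nhds_of_one ho
    (by simpa using hh)
  obtain ⟨g, hg⟩ := hχs V h
  rw [← hχt] at hg
  exact hV (QuotientGroup.eq.1 hg.symm) ⟨g, by simp [T]⟩

/-- Topologically finitely generated profinite groups are Hopfian. -/
theorem injective_of_continuous_surjective {G : Type*} [Group G] [TopologicalSpace G]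
    [IsTopologicalGroup G] [CompactSpace G] [TotallyDisconnectedSpace G]
    {S : Set G} (hfin : S.Finite) (hS : Dense (Subgroup.closure S : Set G))
    (t : G →* G) (hc : Continuous t) (hs : Function.Surjective t) : Function.Injective t := by
  rw [injective_iff_map_eq_one]
  intro x hx
  refine eq_of_forall_openNormalSubgroup fun V => ?_
  have : Finite (G ⧸ V.toSubgroup) := Subgroup.quotient_finite_of_isOpen _ V.isOpen'
  have hF := finite_setOf_isOpen_ker (Q := G ⧸ V.toSubgroup) hfin hS
  -- Precomposition with `t` is an injective self-map of a finite set, hence onto. So the projection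
  -- to `G ⧸ V` factors through `t`, and `ker t` lies in `V`.
  have hmaps : Set.MapsTo (fun φ : G →* G ⧸ V.toSubgroup => φ.comp t)
      {φ | IsOpen (φ.ker : Set G)} {φ | IsOpen (φ.ker : Set G)} :=
    fun φ hφ => IsOpen.preimage hc hφ
  have hinj : Function.Injective (fun φ : G →* G ⧸ V.toSubgroup => φ.comp t) :=
    fun φ ψ h => (MonoidHom.cancel_right hs).1 h
  have := hF.to_subtype
  have hsurj := Finite.surjective_of_injective (hmaps.restrict_inj.2 hinj.injOn)
  obtain ⟨φ, hφ⟩ := hsurj ⟨QuotientGroup.mk' V.toSubgroup, by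
    rw [Set.mem_ofPred_eq, QuotientGroup.ker_mk']; exact V.isOpen'⟩
  have := DFunLike.congr_fun (congrArg Subtype.val hφ) x
  change φ.1 (t x) = x at this
  rw [hx, map_one] at this
  exact this.symm

/-- Every finite group is isomorphic to a group of permutations of some `Fin n`. -/
theorem exists_nonempty_mulEquiv_subgroup_perm_fin (Q : Type*) [Group Q] [Finite Q] :
    ∃ (n : ℕ) (K : Subgroup (Equiv.Perm (Fin n))), Nonempty (Q ≃* K) := by
  obtain ⟨n, ⟨e⟩⟩ := Finite.exists_equiv_fin Q
  let φ : Q →* Equiv.Perm (Fin n) :=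
    e.permCongrHom.toMonoidHom.comp (MulAction.toPermHom Q Q)
  have hφ : Function.Injective φ := e.permCongrHom.injective.comp MulAction.toPerm_injective
  exact ⟨n, φ.range, ⟨MonoidHom.ofInjective hφ⟩⟩

/-- By Cayley's theorem, testing subgroups of the groups `Perm (Fin n)` suffices. This countable
family is independent of `H`, as the Borel invariant requires. -/
theorem exists_continuous_surjective_of_hasOpenQuotient_imp {G H : Type*} [Group G]
    [TopologicalSpace G] [IsTopologicalGroup G] [CompactSpace G]
    {S : Set G} (hfin : S.Finite) (hS : Dense (Subgroup.closure S : Set G))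
    [Group H] [TopologicalSpace H]
    [IsTopologicalGroup H] [CompactSpace H] [TotallyDisconnectedSpace H]
    (h : ∀ (n : ℕ) (K : Subgroup (Equiv.Perm (Fin n))),
      HasOpenQuotient H K → HasOpenQuotient G K) :
    ∃ t : G →* H, Continuous t ∧ Function.Surjective t := by
  refine exists_continuous_surjective_of_hasOpenQuotient hfin hS fun V => ?_
  have : Finite (H ⧸ V.toSubgroup) := Subgroup.quotient_finite_of_isOpen _ V.isOpen'
  obtain ⟨n, K, ⟨e⟩⟩ := exists_nonempty_mulEquiv_subgroup_perm_fin (H ⧸ V.toSubgroup)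
  have hV : HasOpenQuotient H (H ⧸ V.toSubgroup) :=
    ⟨QuotientGroup.mk' _, by rw [QuotientGroup.ker_mk']; exact V.isOpen', QuotientGroup.mk'_surjective _⟩
  exact (h n K (hV.of_mulEquiv e)).of_mulEquiv e.symm

/-- Topologically finitely generated profinite groups with the same finite quotients are
isomorphic. -/
theorem nonempty_continuousMulEquiv_of_hasOpenQuotient_iff {G H : Type*}
    [Group G] [TopologicalSpace G] [IsTopologicalGroup G] [CompactSpace G]
    [TotallyDisconnectedSpace G] {S : Set G} (hfinS : S.Finite)
    (hS : Dense (Subgroup.closure S : Set G))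
    [Group H] [TopologicalSpace H] [IsTopologicalGroup H] [CompactSpace H]
    [TotallyDisconnectedSpace H] {T : Set H} (hfinT : T.Finite)
    (hT : Dense (Subgroup.closure T : Set H))
    (h : ∀ (n : ℕ) (K : Subgroup (Equiv.Perm (Fin n))),
      HasOpenQuotient G K ↔ HasOpenQuotient H K) :
    Nonempty (G ≃ₜ* H) := by
  obtain ⟨f, hfc, hfs⟩ := exists_continuous_surjective_of_hasOpenQuotient_imp hfinS hS
    fun n K => (h n K).2
  obtain ⟨g, hgc, hgs⟩ := exists_continuous_surjective_of_hasOpenQuotient_imp hfinT hT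
    fun n K => (h n K).1
  have hinj : Function.Injective f := Function.Injective.of_comp (f := g)
    (injective_of_continuous_surjective hfinS hS (g.comp f) (hgc.comp hfc) (hgs.comp hfs))
  let e : G ≃* H := MulEquiv.ofBijective f ⟨hinj, hfs⟩
  exact ⟨{ e with
    continuous_toFun := hfc
    continuous_invFun := Continuous.continuous_symm_of_equiv_compact_to_t2 (f := e.toEquiv) hfc }⟩

/-! ### The coded groups are profinite and topologically finitely generated -/

/-- The quotient of a profinite group by a closed normal subgroup is totally disconnected. -/
instance QuotientGroup.instTotallyDisconnectedSpace {G : Type*} [Group G] [TopologicalSpace G]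
    [IsTopologicalGroup G] [CompactSpace G] [TotallyDisconnectedSpace G]
    (N : ClosedNormalSubgroup G) : TotallyDisconnectedSpace (G ⧸ N.toSubgroup) := by
  suffices TotallySeparatedSpace (G ⧸ N.toSubgroup) from inferInstance
  refine totallySeparatedSpace_iff_exists_isClopen.2 fun x y hxy => ?_
  obtain ⟨x, rfl⟩ := QuotientGroup.mk_surjective x
  obtain ⟨y, rfl⟩ := QuotientGroup.mk_surjective y
  have hxN : (1 : G) ∈ (fun u => x⁻¹ * y * u) ⁻¹' (N.toSubgroup : Set G)ᶜ := by
    simpa using fun h => hxy (QuotientGroup.eq.2 h)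
  -- With `x⁻¹yU` disjoint from `N`, the coset of the image of `U` through `x` is clopen and misses
  -- `y`.
  obtain ⟨U, hU⟩ := ProfiniteGrp.exist_openNormalSubgroup_sub_open_nhds_of_one
    (N.isClosed.isOpen_compl.preimage (by fun_prop)) hxN
  let V : Subgroup (G ⧸ N.toSubgroup) := U.toSubgroup.map (QuotientGroup.mk' N.toSubgroup)
  have hV : IsOpen (V : Set (G ⧸ N.toSubgroup)) :=
    QuotientGroup.isOpenMap_coe _ U.isOpen'
  have hcont : Continuous fun z : G ⧸ N.toSubgroup => (x : G ⧸ N.toSubgroup)⁻¹ * z := by fun_prop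
  refine ⟨(fun z => (x : G ⧸ N.toSubgroup)⁻¹ * z) ⁻¹' V,
    ⟨(Subgroup.isClosed_of_isOpen _ hV).preimage hcont, hV.preimage hcont⟩, ?_, ?_⟩
  · simp [V.one_mem]
  · rintro ⟨u, hu, hux⟩
    have hu' : u⁻¹ ∈ U := inv_mem hu
    refine hU hu' ?_
    have : ((x⁻¹ * y * u⁻¹ : G) : G ⧸ N.toSubgroup) = 1 := by
      have : (u : G ⧸ N.toSubgroup) = (x : G ⧸ N.toSubgroup)⁻¹ * y := hux
      rw [QuotientGroup.mk_mul, QuotientGroup.mk_mul, QuotientGroup.mk_inv, QuotientGroup.mk_inv,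
        this, mul_inv_cancel]
    exact (QuotientGroup.eq_one_iff _).1 this

/-- The canonical homomorphism from the free group to the free profinite group. -/
def FreeProfiniteGroup.eta (k : ℕ) : FreeGroup (Fin k) →* FreeProfiniteGroup k :=
  (ProfiniteGrp.ProfiniteCompletion.eta (GrpCat.of (FreeGroup (Fin k)))).hom

theorem FreeProfiniteGroup.denseRange_eta (k : ℕ) : DenseRange (FreeProfiniteGroup.eta k) :=
  ProfiniteGrp.ProfiniteCompletion.denseRange (GrpCat.of (FreeGroup (Fin k)))

theorem FreeProfiniteGroup.dense_closure_range_eta_of (k : ℕ) :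
    Dense (Subgroup.closure (FreeProfiniteGroup.eta k '' Set.range FreeGroup.of) :
      Set (FreeProfiniteGroup k)) := by
  rw [← MonoidHom.map_closure, FreeGroup.closure_range_of, ← MonoidHom.range_eq_map]
  exact FreeProfiniteGroup.denseRange_eta k

/-- The groups coded by points of `FGProfiniteCode` are topologically finitely generated. -/
theorem FGProfiniteCode.exists_finite_dense_closure (c : FGProfiniteCode) :
    ∃ S : Set c.group, S.Finite ∧ Dense (Subgroup.closure S : Set c.group) := by
  refine ⟨QuotientGroup.mk' c.2.toSubgroup ''
    (FreeProfiniteGroup.eta c.1 '' Set.range FreeGroup.of),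
    ((Set.finite_range _).image _).image _, ?_⟩
  rw [← MonoidHom.map_closure, Subgroup.coe_map]
  exact (QuotientGroup.mk'_surjective c.2.toSubgroup).denseRange.dense_image
    QuotientGroup.continuous_mk (FreeProfiniteGroup.dense_closure_range_eta_of c.1)

/-! ### Reduction to equality on ℝ -/

theorem ClosedNormalSubgroup.isOpen_setOf_subset {G : Type*} [Group G] [TopologicalSpace G]
    [CompactSpace G] {U : Set G} (hU : IsOpen U) :
    IsOpen {N : ClosedNormalSubgroup G | (N.toSubgroup : Set G) ⊆ U} :=
  (Compacts.isOpen_subsets_of_isOpen hU).preimage continuous_induced_dom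

/-- The right-hand side is a union over `φ` of conditions placing `N` inside an open set, which are
open in the Vietoris topology. -/
theorem ClosedNormalSubgroup.hasOpenQuotient_iff {G Q : Type*} [Group G] [TopologicalSpace G]
    [Group Q] (N : ClosedNormalSubgroup G) :
    HasOpenQuotient (G ⧸ N.toSubgroup) Q ↔
      ∃ φ : G →* Q, IsOpen (φ.ker : Set G) ∧ Function.Surjective φ ∧
        (N.toSubgroup : Set G) ⊆ φ.ker := by
  constructor
  · rintro ⟨ψ, ho, hs⟩
    refine ⟨ψ.comp (QuotientGroup.mk' N.toSubgroup), ho.preimage QuotientGroup.continuous_mk,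
      hs.comp (QuotientGroup.mk'_surjective _), fun x hx => ?_⟩
    have : (x : G ⧸ N.toSubgroup) = 1 := (QuotientGroup.eq_one_iff x).2 hx
    exact (congrArg ψ this).trans ψ.map_one
  · rintro ⟨φ, ho, hs, hN⟩
    refine ⟨QuotientGroup.lift N.toSubgroup φ hN, ?_, fun q => ?_⟩
    · exact isOpen_coinduced.2 ho
    · obtain ⟨x, rfl⟩ := hs q
      exact ⟨x, rfl⟩

theorem FGProfiniteCode.isOpen_setOf_hasOpenQuotient (Q : Type*) [Group Q] :
    IsOpen {c : FGProfiniteCode | HasOpenQuotient c.group Q} := by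
  rw [isOpen_sigma_iff]
  intro k
  have : Sigma.mk k ⁻¹' {c : FGProfiniteCode | HasOpenQuotient c.group Q} =
      ⋃ φ ∈ {φ : FreeProfiniteGroup k →* Q |
        IsOpen (φ.ker : Set (FreeProfiniteGroup k)) ∧ Function.Surjective φ},
        {N : ClosedNormalSubgroup (FreeProfiniteGroup k) |
          (N.toSubgroup : Set (FreeProfiniteGroup k)) ⊆ φ.ker} := by
    ext N
    refine (N.hasOpenQuotient_iff (Q := Q)).trans ?_
    simp [and_assoc]
  rw [this]
  exact isOpen_biUnion fun φ hφ => ClosedNormalSubgroup.isOpen_setOf_subset hφ.1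

theorem fgProfiniteIso_iff_hasOpenQuotient (c d : FGProfiniteCode) :
    fgProfiniteIso c d ↔ ∀ (n : ℕ) (K : Subgroup (Equiv.Perm (Fin n))),
      HasOpenQuotient c.group K ↔ HasOpenQuotient d.group K := by
  constructor
  · rintro ⟨e⟩ n K
    exact ⟨fun h => h.of_continuousMulEquiv e, fun h => h.of_continuousMulEquiv e.symm⟩
  · intro h
    obtain ⟨S, hS, hS'⟩ := c.exists_finite_dense_closure
    obtain ⟨T, hT, hT'⟩ := d.exists_finite_dense_closure
    exact nonempty_continuousMulEquiv_of_hasOpenQuotient_iff hS hS' hT hT' h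

theorem fgProfiniteIso_borelReducible : BorelReducible fgProfiniteIso (⊥ : Setoid ℝ) := by
  classical
  let I : Type := Σ n : ℕ, Subgroup (Equiv.Perm (Fin n))
  let f : FGProfiniteCode → I → Bool := fun c i => decide (HasOpenQuotient c.group i.2)
  have hf : @Measurable _ _ (borel FGProfiniteCode) inferInstance f := by
    let _ := borel FGProfiniteCode
    have : BorelSpace FGProfiniteCode := ⟨rfl⟩
    refine measurable_pi_iff.2 fun i => measurable_to_bool ?_
    have := (FGProfiniteCode.isOpen_setOf_hasOpenQuotient i.2).measurableSet
    convert this using 1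
    ext c
    simp [f]
  -- `I` is countable, so `I → Bool` is a standard Borel space.
  obtain ⟨e, he⟩ := MeasureTheory.exists_measurableEmbedding_real (I → Bool)
  refine ⟨e ∘ f, ?_, fun c d => ?_⟩
  · rw [← BorelSpace.measurable_eq (α := ℝ)]
    exact he.measurable.comp hf
  · rw [fgProfiniteIso_iff_hasOpenQuotient]
    change _ ↔ e (f c) = e (f d)
    rw [he.injective.eq_iff]
    constructor
    · intro h
      funext i
      simp [f, h i.1 i.2]
    · intro h n K
      simpa [f] using congrFun h ⟨n, K⟩

/-! ### Reduction of equality on ℝ to isomorphism -/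

/-- A homomorphism from the free group to a finite group extends to the free profinite group. -/
theorem FreeProfiniteGroup.exists_extension {k : ℕ} {Q : Type*} [Group Q] [Finite Q]
    (f : FreeGroup (Fin k) →* Q) :
    ∃ φ : FreeProfiniteGroup k →* Q, IsOpen (φ.ker : Set (FreeProfiniteGroup k)) ∧
      ∀ w, φ (FreeProfiniteGroup.eta k w) = f w := by
  have : Finite (FreeGroup (Fin k) ⧸ f.ker) :=
    Finite.of_injective _ (QuotientGroup.kerLift_injective f)
  have : f.ker.FiniteIndex := Subgroup.finiteIndex_of_finite_quotient
  let N : FiniteIndexNormalSubgroup (GrpCat.of (FreeGroup (Fin k))) :=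
    FiniteIndexNormalSubgroup.ofSubgroup f.ker
  let D := ProfiniteGrp.ProfiniteCompletion.diagram (GrpCat.of (FreeGroup (Fin k)))
  let π : FreeProfiniteGroup k →* FreeGroup (Fin k) ⧸ f.ker :=
    { toFun := fun x => x.1 N
      map_one' := rfl
      map_mul' := fun _ _ => rfl }
  have hπ : IsOpen (π.ker : Set (FreeProfiniteGroup k)) := by
    have hd : DiscreteTopology (D.obj N) := ⟨rfl⟩
    have hc : Continuous fun x : FreeProfiniteGroup k => (x.1 N : D.obj N) :=
      (continuous_apply N).comp continuous_subtype_val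
    exact (isOpen_discrete ({1} : Set (D.obj N))).preimage hc
  refine ⟨(QuotientGroup.kerLift f).comp π, ?_, fun w => rfl⟩
  exact Subgroup.isOpen_mono (H₁ := π.ker)
    (fun x hx => by simp [MonoidHom.mem_ker, MonoidHom.mem_ker.1 hx]) hπ

/-- An antitone family of closed normal subgroups indexed by the reals is Borel. -/
theorem ClosedNormalSubgroup.measurable_of_antitone {G : Type*} [Group G] [TopologicalSpace G]
    [IsTopologicalGroup G] [CompactSpace G] [PolishSpace G] {f : ℝ → ClosedNormalSubgroup G}
    (hf : ∀ r s, r ≤ s → (f s).toSubgroup ≤ (f r).toSubgroup) :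
    @Measurable _ _ (borel ℝ) (borel (ClosedNormalSubgroup G)) f := by
  rw [← BorelSpace.measurable_eq (α := ℝ)]
  have htop : (instTopologicalSpace : TopologicalSpace (ClosedNormalSubgroup G)) =
      .generateFrom (Set.preimage (fun N => (N.toSubgroup : Set G)) ''
        (Set.powerset '' {U | IsOpen U} ∪
          (fun V => {s : Set G | (s ∩ V).Nonempty}) '' {V | IsOpen V})) := by
    rw [← induced_generateFrom_eq]
    exact induced_compose
  rw [borel_eq_generateFrom_of_subbasis htop]
  refine measurable_generateFrom ?_
  rintro _ ⟨_, ⟨U, -, rfl⟩ | ⟨U, -, rfl⟩, rfl⟩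
  -- By antitonicity, the preimages of the two kinds of subbasic Vietoris sets are upper and lower
  -- sets of reals.
  · refine Set.OrdConnected.measurableSet (IsUpperSet.ordConnected fun r s hrs hr => ?_)
    exact Set.Subset.trans (SetLike.coe_subset_coe.2 (hf r s hrs)) hr
  · refine Set.OrdConnected.measurableSet (IsLowerSet.ordConnected fun r s hrs hr => ?_)
    obtain ⟨x, hx, hxU⟩ := hr
    exact ⟨x, hf s r hrs hx, hxU⟩

theorem exists_injective_rat_primes : ∃ p : ℚ → ℕ, Function.Injective p ∧ ∀ q, (p q).Prime :=
  ⟨fun q => (Infinite.natEmbedding Nat.Primes (Encodable.encode q) : ℕ),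
    fun _ _ h => Encodable.encode_injective
      ((Infinite.natEmbedding Nat.Primes).injective (Subtype.val_injective h)),
    fun q => (Infinite.natEmbedding Nat.Primes (Encodable.encode q)).2⟩

/-- The intersection of the kernels of homomorphisms with open kernels. -/
def ClosedNormalSubgroup.iInfKer {G ι : Type*} [Group G] [TopologicalSpace G]
    [IsTopologicalGroup G] {Q : ι → Type*} [∀ i, Group (Q i)] (φ : ∀ i, G →* Q i)
    (hφ : ∀ i, IsOpen ((φ i).ker : Set G)) (A : Set ι) : ClosedNormalSubgroup G where
  toSubgroup := ⨅ i : A, (φ i).ker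
  isClosed := by
    rw [Subgroup.coe_iInf]
    exact isClosed_iInter fun i => Subgroup.isClosed_of_isOpen _ (hφ i)
  normal := Subgroup.normal_iInf_normal fun i => inferInstance

/-- If `x` maps to a generator of `ℤ/p i` under `φ i` for each `i` and generates `G` topologically,
then the procyclic group `G / ⋂ i ∈ A, ker (φ i)` has a quotient of order `p j` iff `j ∈ A`. -/
theorem ClosedNormalSubgroup.hasOpenQuotient_iInfKer_iff {G ι : Type*} [Group G]
    [TopologicalSpace G] [IsTopologicalGroup G] [CompactSpace G] {p : ι → ℕ}
    (hp : Function.Injective p) (hprime : ∀ i, (p i).Prime)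
    (φ : ∀ i, G →* Multiplicative (ZMod (p i))) (hφ : ∀ i, IsOpen ((φ i).ker : Set G))
    {x : G} (hx : Dense (Subgroup.closure {x} : Set G))
    (hφx : ∀ i, φ i x = Multiplicative.ofAdd 1) (A : Set ι) (j : ι) :
    HasOpenQuotient (G ⧸ (iInfKer φ hφ A).toSubgroup) (Multiplicative (ZMod (p j))) ↔ j ∈ A := by
  rw [ClosedNormalSubgroup.hasOpenQuotient_iff]
  constructor
  · rintro ⟨ψ, ho, hs, hle⟩
    by_contra hj
    have hcompact : IsCompact ((ψ.ker : Set G)ᶜ) := ho.isClosed_compl.isCompact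
    -- By compactness, finitely many of the kernels already intersect inside `ker ψ`. The product of
    -- their primes then kills `ψ x` and is coprime to `p j`, so `ψ` is trivial.
    obtain ⟨u, hu⟩ := hcompact.elim_finite_subfamily_closed (fun i : A => ((φ i).ker : Set G))
      (fun i => Subgroup.isClosed_of_isOpen _ (hφ i)) (by
        rw [← Set.disjoint_iff_inter_eq_empty, Set.disjoint_compl_left_iff_subset]
        rw [← Subgroup.coe_iInf]
        exact hle)
    rw [← Set.disjoint_iff_inter_eq_empty, Set.disjoint_compl_left_iff_subset] at hu
    have hxm : x ^ (∏ i ∈ u, p i) ∈ (ψ.ker : Set G) := by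
      refine hu (Set.mem_iInter₂.2 fun i hi => ?_)
      have hdvd : p i ∣ ∏ i ∈ u, p i := Finset.dvd_prod_of_mem (fun i : A => p i) hi
      change φ i _ = 1
      rw [map_pow, hφx, ← ofAdd_nsmul, nsmul_one, (ZMod.natCast_eq_zero_iff _ _).2 hdvd, ofAdd_zero]
    have h1 : orderOf (ψ x) ∣ ∏ i ∈ u, p i := by
      rw [orderOf_dvd_iff_pow_eq_one, ← map_pow]
      exact hxm
    have h2 : orderOf (ψ x) ∣ p j := by
      exact (orderOf_dvd_natCard (ψ x)).trans (Nat.card_zmod (p j)).dvd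
    have hcop : Nat.Coprime (∏ i ∈ u, p i) (p j) :=
      Nat.Coprime.prod_left fun i _ => (Nat.coprime_primes (hprime i) (hprime j)).2
        fun h => hj (hp h ▸ i.2)
    have h3 : ψ x = 1 := orderOf_eq_one_iff.1 (Nat.eq_one_of_dvd_coprimes hcop h1 h2)
    have h4 : ψ = 1 := MonoidHom.eq_of_eqOn_dense_of_isOpen_ker hx ho (by simp) (by simpa using h3)
    have : Fact (p j).Prime := ⟨hprime j⟩
    obtain ⟨g, hg⟩ := hs (Multiplicative.ofAdd 1)
    rw [h4] at hg
    exact one_ne_zero (α := ZMod (p j)) (Multiplicative.ofAdd.injective hg.symm)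
  · intro hj
    refine ⟨φ j, hφ j, fun z => ⟨x ^ (Multiplicative.toAdd z).val, ?_⟩, ?_⟩
    · have : NeZero (p j) := ⟨(hprime j).ne_zero⟩
      rw [map_pow, hφx, ← ofAdd_nsmul, nsmul_one, ZMod.natCast_zmod_val, ofAdd_toAdd]
    · exact SetLike.coe_subset_coe.2 (iInf_le (fun i : A => (φ i).ker) ⟨j, hj⟩)

theorem borelReducible_fgProfiniteIso : BorelReducible (⊥ : Setoid ℝ) fgProfiniteIso := by
  obtain ⟨p, hp, hprime⟩ := exists_injective_rat_primes
  have hne : ∀ q, NeZero (p q) := fun q => ⟨(hprime q).ne_zero⟩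
  choose φ hφ hφe using fun q => FreeProfiniteGroup.exists_extension (k := 1)
    (FreeGroup.lift fun _ => (Multiplicative.ofAdd 1 : Multiplicative (ZMod (p q))))
  let x : FreeProfiniteGroup 1 := FreeProfiniteGroup.eta 1 (FreeGroup.of 0)
  have hx : Dense (Subgroup.closure {x} : Set (FreeProfiniteGroup 1)) := by
    have := FreeProfiniteGroup.dense_closure_range_eta_of 1
    rwa [Set.range_unique, Set.image_singleton] at this
  have hφx : ∀ q, φ q x = Multiplicative.ofAdd 1 := fun q => by simp [x, hφe]
  -- The quotients of order `p q` recover the Dedekind cut of `r`; nested cuts make `N` antitone.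
  let N : ℝ → ClosedNormalSubgroup (FreeProfiniteGroup 1) :=
    fun r => ClosedNormalSubgroup.iInfKer φ hφ {q : ℚ | (q : ℝ) < r}
  have hN := fun r => ClosedNormalSubgroup.hasOpenQuotient_iInfKer_iff hp hprime φ hφ hx hφx
    {q : ℚ | (q : ℝ) < r}
  refine ⟨fun r => ⟨1, N r⟩, ?_, fun r s => ⟨?_, fun h => ?_⟩⟩
  · have h1 := ClosedNormalSubgroup.measurable_of_antitone (f := N) fun r s hrs =>
      le_iInf fun i => iInf_le (fun i : {q : ℚ | (q : ℝ) < s} => (φ i).ker)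
        ⟨i.1, lt_of_lt_of_le i.2 hrs⟩
    have h2 : @Measurable _ _ (borel _) (borel FGProfiniteCode) (Sigma.mk 1) := by
      refine Continuous.borel_measurable ?_
      exact continuous_sigmaMk
    exact h2.comp h1
  · rintro rfl
    exact fgProfiniteIso.refl _
  · rw [fgProfiniteIso_iff_hasOpenQuotient] at h
    have key : ∀ q : ℚ, (q : ℝ) < r ↔ (q : ℝ) < s := by
      intro q
      obtain ⟨n, K, ⟨e⟩⟩ :=
        exists_nonempty_mulEquiv_subgroup_perm_fin (Multiplicative (ZMod (p q)))
      exact (hN r q).symm.trans (Iff.trans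
        ⟨fun hq => ((h n K).1 (hq.of_mulEquiv e)).of_mulEquiv e.symm,
          fun hq => ((h n K).2 (hq.of_mulEquiv e)).of_mulEquiv e.symm⟩ (hN s q))
    refine le_antisymm (le_of_not_gt fun hlt => ?_) (le_of_not_gt fun hlt => ?_)
    · obtain ⟨q, h1, h2⟩ := exists_rat_btwn hlt
      exact lt_asymm h1 ((key q).1 h2)
    · obtain ⟨q, h1, h2⟩ := exists_rat_btwn hlt
      exact lt_asymm h1 ((key q).2 h2)

theorem theorem3p1 : BorelBireducible fgProfiniteIso (⊥ : Setoid ℝ) :=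
  ⟨fgProfiniteIso_borelReducible, borelReducible_fgProfiniteIso⟩
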